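/- **Setting.** Let $\mathcal Q=\{1,\dots,\overline q\}=\mathcal Q_s\cup\mathcal Q_u$ be a disjoint union with $\mathcal Q_u\neq\emptyset$. Consider the switched plants $$\dot x=d_q(x)+\mathbb I_{\mathcal Q_s}(q)\,b_q(x)\,u_q(x,\mu_k),\qquad x\in\mathbb R^n,\ q\in\mathcal Q,$$ where the unknown maps $d_q:\mathbb R^n\to\mathbb R^n$ and $b_q:\mathbb R^n\to\mathbb R^{n\times n}$ are locally Lipschitz, $|d_q(x)|\le\overline d_q(x)$ for all $q\in\mathcal Q$, $x\in\mathbb R^n$, and $b_q(x)+b_q(x)^\top\succeq\epsilon I_n$ for all $q\in\mathcal Q_s$, $x\in\mathbb R^n$, with $\epsilon>0$. The known functions $\overline d_q:\mathbb R^n\to(0,\infty)$ are continuous for $q\in\mathcal Q$ and globally Lipschitz for $q\in\mathcal Q_u$. The feedback is $u_q(x,\mu_k)=-\mu_k\left(\eta_q+\delta_q\overline d_q(x)^2\right)x$ with $\eta_q,\delta_q>0$. For $\tau_d,\tau_a,T>0$, $k\ge1$, $N_0\ge1$, $T_0\ge0$, the closed loop is the hybrid system with state $z=(x,\tau,\rho,q,\mu_k)\in\mathbb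 R^{n+4}$ that may flow when $\tau\in[0,N_0]$, $\rho\in[0,T_0]$, $q\in\mathcal Q$, $\mu_k\ge1$, according to $$\dot x=d_q(x)+\mathbb I_{\mathcal Q_s}(q)b_q(x)u_q(x,\mu_k),\quad \dot\tau\in\left[0,\tfrac{\mu_k}{\tau_d}\right],\quad \dot\rho\in\left[0,\tfrac{\mu_k}{\tau_a}\right]-\mu_k\mathbb I_{\mathcal Q_u}(q),\quad \dot q=0,\quad \dot\mu_k=\tfrac kT\mu_k^{1+1/k},$$ and may jump when $\tau\in[1,N_0]$, $\rho\in[0,T_0]$, $q\in\mathcal Q$, $\mu_k\ge1$, according to $$x^+=x,\quad \tau^+=\tau-1,\quad \rho^+=\rho,\quad q^+\in\mathcal Q\setminus\{q\},\quad \mu_k^+=\mu_k .$$ Let $\mathcal A_1=\{0\}\times[0,N_0]\times[0,T_0]\times\mathcal Q$ and $\mathcal A=\mathcal A_1\times[1,\infty)$, and let $|z|_{\mathcal A}$ be the Euclidean distance of $z$ to $\mathcal A$. For a solution with $\mu_k(0,0)=\mu_0$ put $\mu_k(t)=T^k/(T\mu_0^{-1/k}-t)^k$ and $\mathcal T_k(t)=\omega_k(\mu_k(t),\mu_0)$,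 where $\omega_k(b,a)=\frac{T}{k-1}\left(b^{(k-1)/k}-a^{(k-1)/k}\right)$ for $k>1$ and $\omega_1(b,a)=T\ln(b/a)$. **Statement.** There exist $\tau_d>0$ and $\tau_a>0$, depending only on $n,\mathcal Q_s,\mathcal Q_u,\epsilon$ and $(\overline d_q,\eta_q,\delta_q)_{q\in\mathcal Q}$, such that for all $d_q,b_q$ as above and all $N_0\ge1$, $T_0\ge0$, $T>0$, $k\ge1$, the closed loop renders the compact-times-half-line set $\mathcal A=\mathcal A_1\times\mathbb R_{\ge1}$ PT-ISS-C$_{\mathrm F}$ (prescribed-time input-to-state stable and convergent via flows), the input being a bound on the relative size of the drift. That is, there are $\beta\in\mathcal{KLL}$, $\gamma\in\mathcal K$ and $\beta_c\in\mathcal{KL}$ such that, for every solution $z$ of the closed loop and every hybrid input $w:\mathrm{dom}(z)\to\mathbb R$ (for each $j$ measurable and locally essentially bounded in $t$) satisfying $|d_q(x)|\le\overline d_q(x)\,|w|$ along $z$, $$|z(t,j)|_{\mathcal A}\le\beta_c\Big(\beta\big(|z(0,0)|_{\mathcal A},\mathcal T_k(t),j\big)+\gamma\big(|w|_{(t,j)}\big),\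 \mathcal T_k(t)\Big)\qquad\text{for all }(t,j)\in\mathrm{dom}(z)\text{ with }|w|_{(t,j)}<\infty,$$ where $|w|_{(t,j)}$ is the supremum of $|w(t',j')|$ over $(t',j')\in\mathrm{dom}(z)$ with $t'\le t$, $j'\le j$. In particular, the constant input $w\equiv1$ is always allowed. Here $\gamma\in\mathcal K$ means that $\gamma:\mathbb R_{\ge0}\to\mathbb R_{\ge0}$ is continuous and strictly increasing with $\gamma(0)=0$; $\beta_c\in\mathcal{KL}$ means that $\beta_c:\mathbb R_{\ge0}^2\to\mathbb R_{\ge0}$ is nondecreasing in its first and nonincreasing in its second argument, with $\lim_{r\to0^+}\beta_c(r,s)=0$ for each $s$ and $\lim_{s\to\infty}\beta_c(r,s)=0$ for each $r$; and $\beta\in\mathcal{KLL}$ means that $\beta(\cdot,s,\cdot)$ and $\beta(\cdot,\cdot,s)$ are in $\mathcal{KL}$ for every $s\ge0$. -/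

import Mathlib

open Filter Topology MeasureTheory
open scoped NNReal

noncomputable section

namespace PrescribedTime

/-! ### Comparison functions (as functions of nonnegative reals) -/

/-- Class `K`: continuous, strictly increasing, zero at zero. -/
structure IsClassK (γ : ℝ → ℝ) : Prop where
  continuousOn : ContinuousOn γ (Set.Ici 0)
  strictMonoOn : StrictMonoOn γ (Set.Ici 0)
  map_zero : γ 0 = 0

/-- Class `KL`: nonnegative, nondecreasing in the first argument, nonincreasing in the second,
tending to `0` as the first argument tends to `0⁺` and as the second one tends to `∞`. -/
structure IsClassKL (β : ℝ → ℝ → ℝ) : Prop where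
  nonneg : ∀ r s : ℝ, 0 ≤ r → 0 ≤ s → 0 ≤ β r s
  monotoneOn : ∀ s : ℝ, 0 ≤ s → MonotoneOn (fun r => β r s) (Set.Ici 0)
  antitoneOn : ∀ r : ℝ, 0 ≤ r → AntitoneOn (fun s => β r s) (Set.Ici 0)
  tendsto_left : ∀ s : ℝ, 0 ≤ s → Tendsto (fun r => β r s) (𝓝[>] 0) (𝓝 0)
  tendsto_right : ∀ r : ℝ, 0 ≤ r → Tendsto (fun s => β r s) atTop (𝓝 0)

/-- Class `KLL`: class `KL` in (first, third) and in (first, second) arguments, for every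
fixed value of the remaining one. -/
structure IsClassKLL (β : ℝ → ℝ → ℝ → ℝ) : Prop where
  kl_third : ∀ s : ℝ, 0 ≤ s → IsClassKL (fun r t => β r s t)
  kl_second : ∀ s : ℝ, 0 ≤ s → IsClassKL (fun r t => β r t s)

/-! ### Hybrid time domains, hybrid arcs, hybrid systems with inputs -/

/-- `E = ⋃_{j < J} [t_j, t_{j+1}] × {j}` for some `0 = t_0 ≤ t_1 ≤ ... ≤ t_J`. -/
def IsCompactHTD (E : Set (ℝ × ℕ)) : Prop :=
  ∃ (J : ℕ) (t : ℕ → ℝ), t 0 = 0 ∧ (∀ j < J, t j ≤ t (j + 1)) ∧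
    E = {p : ℝ × ℕ | p.2 < J ∧ t p.2 ≤ p.1 ∧ p.1 ≤ t (p.2 + 1)}

/-- Hybrid time domains. -/
def IsHTD (E : Set (ℝ × ℕ)) : Prop :=
  (∀ p ∈ E, 0 ≤ p.1) ∧
  ∀ p ∈ E, IsCompactHTD (E ∩ {p' : ℝ × ℕ | 0 ≤ p'.1 ∧ p'.1 ≤ p.1 ∧ p'.2 ≤ p.2})

/-- The set `I_j` of times `t` with `(t, j)` in the domain. -/
def slice (E : Set (ℝ × ℕ)) (j : ℕ) : Set ℝ := {t : ℝ | (t, j) ∈ E}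

/-- Hybrid inputs on `E`: for every `j`, measurable and locally essentially bounded in `t`.
(Hybrid signals are represented by total functions; only the values on `E` matter.) -/
structure IsHybridInput {U : Type*} [NormedAddCommGroup U]
    (E : Set (ℝ × ℕ)) (u : ℝ → ℕ → U) : Prop where
  measurable : ∀ j, AEStronglyMeasurable (fun t => u t j) (volume.restrict (slice E j))
  locBounded : ∀ j, ∀ K ⊆ slice E j, IsCompact K →
    ∃ M : ℝ, ∀ᵐ t ∂(volume.restrict K), ‖u t j‖ ≤ M

/-- Hybrid arcs on `E`: for every `j`, locally absolutely continuous in `t ∈ I_j`. -/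
def IsHybridArc {Z : Type*} [NormedAddCommGroup Z]
    (E : Set (ℝ × ℕ)) (z : ℝ → ℕ → Z) : Prop :=
  ∀ j, ∀ a ∈ slice E j, ∀ b ∈ slice E j, a ≤ b →
    AbsolutelyContinuousOnInterval (fun t => z t j) a b

/-- The data of a hybrid system with inputs: flow set, flow map, jump set, jump map. -/
structure HybridSystem (Z U : Type*) where
  /-- flow set -/
  C : Set Z
  /-- flow map -/
  F : Z → U → Set Z
  /-- jump set -/
  D : Set Z
  /-- jump map -/
  G : Z → Set Z

/-- `(z, u)` with common domain `E` is a solution pair of the hybrid system `H`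
(not necessarily maximal or complete). -/
structure HybridSystem.IsSolutionPair {Z U : Type*} [NormedAddCommGroup Z] [NormedSpace ℝ Z]
    [NormedAddCommGroup U] (H : HybridSystem Z U)
    (E : Set (ℝ × ℕ)) (z : ℝ → ℕ → Z) (u : ℝ → ℕ → U) : Prop where
  htd : IsHTD E
  arc : IsHybridArc E z
  input : IsHybridInput E u
  zero_mem : ((0 : ℝ), (0 : ℕ)) ∈ E
  init : z 0 0 ∈ H.C ∪ H.D
  flow : ∀ j, (interior (slice E j)).Nonempty → ∀ᵐ t ∂(volume.restrict (slice E j)),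
    z t j ∈ H.C ∧ ∃ v ∈ H.F (z t j) (u t j), HasDerivAt (fun s => z s j) v t
  jump : ∀ t j, (t, j) ∈ E → (t, j + 1) ∈ E →
    z t j ∈ H.D ∧ z t (j + 1) ∈ H.G (z t j)

/-- The norms `|u(t', j')|` over `(t', j') ∈ E` with `(t', j') ≤ (t, j)`. -/
def inputNorms {U : Type*} [NormedAddCommGroup U]
    (E : Set (ℝ × ℕ)) (u : ℝ → ℕ → U) (t : ℝ) (j : ℕ) : Set ℝ :=
  {r : ℝ | ∃ (t' : ℝ) (j' : ℕ), (t', j') ∈ E ∧ t' ≤ t ∧ j' ≤ j ∧ r = ‖u t' j'‖}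

/-! ### Blow-up gain and time dilation -/

/-- The gain `μ_k(t) = T^k / (Υ - t)^k`, `Υ = T μ₀^(-1/k)`, which solves
`μ' = (k/T) μ^(1+1/k)`, `μ(0) = μ₀`, on `[0, Υ)`. -/
def blowUpGain (T k μ₀ t : ℝ) : ℝ := T ^ k / (T * μ₀ ^ (-(1 / k)) - t) ^ k

/-- `ω_k(b, a)`; the value for `k = 1` is the limit as `k → 1⁺`. -/
def omegaK (T k b a : ℝ) : ℝ :=
  if k = 1 then T * (Real.log b - Real.log a)
  else T / k * ((b ^ ((k - 1) / k) - 1) / ((k - 1) / k) - (a ^ ((k - 1) / k) - 1) / ((k - 1) / k))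

/-- The dilation `𝒯_k(t) = ω_k(μ_k(t), μ_k(0))` on `[0, Υ)`, for the initial gain `μ₀`. -/
def dilation (T k μ₀ t : ℝ) : ℝ := omegaK T k (blowUpGain T k μ₀ t) (blowUpGain T k μ₀ 0)

/-! ### Hybrid systems with blow-up gain and prescribed-time stability -/

/-- The state space `P × ℝ` of `z = (ψ, μ)`, with the Euclidean norm. -/
abbrev GainState (P : Type*) : Type _ := WithLp 2 (P × ℝ)

/-- The hybrid system with state `z = (ψ, μ)`:
`ψ' ∈ μ F_Ψ(ψ, u, μ)`, `μ' = (k/T) μ^(1+1/k)` on `Ψ_C × [1,∞)`, and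
`ψ⁺ ∈ G_Ψ(ψ)`, `μ⁺ = μ` on `Ψ_D × [1,∞)`. -/
def blowUpSystem {P U : Type*} [NormedAddCommGroup P] [NormedSpace ℝ P] (T k : ℝ)
    (ΨC : Set P) (FΨ : P → U → ℝ → Set P) (ΨD : Set P) (GΨ : P → Set P) :
    HybridSystem (GainState P) U where
  C := {z | z.fst ∈ ΨC ∧ 1 ≤ z.snd}
  F := fun z u => {v | ∃ w ∈ FΨ z.fst u z.snd,
    v = WithLp.toLp 2 (z.snd • w, k / T * z.snd ^ (1 + 1 / k))}
  D := {z | z.fst ∈ ΨD ∧ 1 ≤ z.snd}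
  G := fun z => {z' | z'.fst ∈ GΨ z.fst ∧ z'.snd = z.snd}

/-- Prescribed-time input-to-state stability with convergence, via flows, of `A₁ × [1,∞)` for a
hybrid system with blow-up gain. The input ranges over the hybrid inputs that are related to the
arc by `Adm` (take `Adm` always true for arbitrary exogenous inputs). The bound is asserted whenever
the supremum `|u|_(t,j)` is finite. -/
def PTISSC {P U : Type*} [NormedAddCommGroup P] [NormedSpace ℝ P] [NormedAddCommGroup U]
    (T k : ℝ) (H : HybridSystem (GainState P) U) (A₁ : Set P)
    (Adm : Set (ℝ × ℕ) → (ℝ → ℕ → GainState P) → (ℝ → ℕ → U) → Prop) : Prop :=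
  IsCompact A₁ ∧
  ∃ (β : ℝ → ℝ → ℝ → ℝ) (γ : ℝ → ℝ) (βc : ℝ → ℝ → ℝ),
    IsClassKLL β ∧ IsClassK γ ∧ IsClassKL βc ∧
    ∀ (E : Set (ℝ × ℕ)) (z : ℝ → ℕ → GainState P) (u : ℝ → ℕ → U),
      H.IsSolutionPair E z u → Adm E z u →
      ∀ t j, (t, j) ∈ E → BddAbove (inputNorms E u t j) →
        Metric.infDist (z t j) {z' : GainState P | z'.fst ∈ A₁ ∧ 1 ≤ z'.snd} ≤
          βc (β (Metric.infDist (z 0 0) {z' : GainState P | z'.fst ∈ A₁ ∧ 1 ≤ z'.snd})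
                (dilation T k (z 0 0).snd t) (j : ℝ)
              + γ (sSup (inputNorms E u t j)))
            (dilation T k (z 0 0).snd t)

/-! ### Switching systems with unstable modes as hybrid systems -/

/-- The space `ℝ^(n+3) = ℝⁿ × ℝ³` of `ψ = (x, (τ, ρ, q))` with the Euclidean norm: plant state,
dwell-time timer, activation-time monitor, mode (a real number that takes natural values). -/
def SwitchState (n : ℕ) : Type := WithLp 2 (EuclideanSpace ℝ (Fin n) × EuclideanSpace ℝ (Fin 3))

instance (n : ℕ) : NormedAddCommGroup (SwitchState n) :=
  inferInstanceAs
    (NormedAddCommGroup (WithLp 2 (EuclideanSpace ℝ (Fin n) × EuclideanSpace ℝ (Fin 3))))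

instance (n : ℕ) : InnerProductSpace ℝ (SwitchState n) :=
  inferInstanceAs
    (InnerProductSpace ℝ (WithLp 2 (EuclideanSpace ℝ (Fin n) × EuclideanSpace ℝ (Fin 3))))

namespace SwitchState

variable {n : ℕ}

/-- plant state -/
def x (ψ : SwitchState n) : EuclideanSpace ℝ (Fin n) := WithLp.fst (p := 2) ψ
/-- the triple `(τ, ρ, q)` -/
def aux (ψ : SwitchState n) : EuclideanSpace ℝ (Fin 3) := WithLp.snd (p := 2) ψ
/-- dwell-time timer -/
def τ (ψ : SwitchState n) : ℝ := ψ.aux 0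
/-- activation-time monitor -/
def ρ (ψ : SwitchState n) : ℝ := ψ.aux 1
/-- mode -/
def q (ψ : SwitchState n) : ℝ := ψ.aux 2
/-- `(x, τ, ρ, q)` as an element of `ℝ^(n+3)` -/
def mk (x : EuclideanSpace ℝ (Fin n)) (τ ρ q : ℝ) : SwitchState n :=
  WithLp.toLp 2 (x, !₂[τ, ρ, q])

@[simp] theorem x_mk (x : EuclideanSpace ℝ (Fin n)) (τ ρ q : ℝ) : (mk x τ ρ q).x = x := rfl
@[simp] theorem τ_mk (x : EuclideanSpace ℝ (Fin n)) (τ ρ q : ℝ) : (mk x τ ρ q).τ = τ := rfl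
@[simp] theorem ρ_mk (x : EuclideanSpace ℝ (Fin n)) (τ ρ q : ℝ) : (mk x τ ρ q).ρ = ρ := rfl
@[simp] theorem q_mk (x : EuclideanSpace ℝ (Fin n)) (τ ρ q : ℝ) : (mk x τ ρ q).q = q := rfl

end SwitchState

/-- `ℝⁿ × [a, N₀] × [0, T₀] × 𝒬`; the flow set has `a = 0`, the jump set has `a = 1`. -/
def switchSet (n : ℕ) (Q : Finset ℕ) (a N₀ T₀ : ℝ) : Set (SwitchState n) :=
  {ψ | ψ.τ ∈ Set.Icc a N₀ ∧ ψ.ρ ∈ Set.Icc 0 T₀ ∧ ∃ i ∈ Q, ψ.q = (i : ℝ)}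

/-- The set-valued flow map
`{f_q(x, u, τ, μ)} × [0, 1/τ_d] × ([0, 1/τ_a] - 𝟙_{𝒬_u}(q)) × {0}`. -/
def switchFlow {n : ℕ} {U : Type*} (Q Qu : Finset ℕ) (τd τa : ℝ)
    (f : ℕ → EuclideanSpace ℝ (Fin n) → U → ℝ → ℝ → EuclideanSpace ℝ (Fin n)) :
    SwitchState n → U → ℝ → Set (SwitchState n) :=
  fun ψ u μ => {v | ∃ i ∈ Q, ψ.q = (i : ℝ) ∧
    ∃ r ∈ Set.Icc 0 (1 / τd), ∃ s ∈ Set.Icc 0 (1 / τa),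
      v = SwitchState.mk (f i ψ.x u ψ.τ μ) r (s - if i ∈ Qu then 1 else 0) 0}

/-- The set-valued jump map `{R_q(x)} × {τ - 1} × {ρ} × (𝒬 \ {q})`. -/
def switchJump {n : ℕ} (Q : Finset ℕ)
    (R : ℕ → EuclideanSpace ℝ (Fin n) → EuclideanSpace ℝ (Fin n)) :
    SwitchState n → Set (SwitchState n) :=
  fun ψ => {ψ' | ∃ i ∈ Q, ψ.q = (i : ℝ) ∧ ∃ i' ∈ Q, i' ≠ i ∧
    ψ' = SwitchState.mk (R i ψ.x) (ψ.τ - 1) ψ.ρ (i' : ℝ)}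

/-- The target set `{0} × [0, N₀] × [0, T₀] × 𝒬`. -/
def targetSet (n : ℕ) (Q : Finset ℕ) (N₀ T₀ : ℝ) : Set (SwitchState n) :=
  {ψ | ψ.x = 0 ∧ ψ ∈ switchSet n Q 0 N₀ T₀}

/-! ### Switched plants with intermittent feedback -/

/-- The feedback `u_q(x, μ) = -μ (η_q + δ_q d̄_q(x)²) x`. -/
def feedback {n : ℕ} (η δ : ℕ → ℝ) (dbar : ℕ → EuclideanSpace ℝ (Fin n) → ℝ)
    (q : ℕ) (x : EuclideanSpace ℝ (Fin n)) (μ : ℝ) : EuclideanSpace ℝ (Fin n) :=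
  (-(μ * (η q + δ q * dbar q x ^ 2))) • x

/-- The plant `d_q(x) + 𝟙_{𝒬_s}(q) b_q(x) v` with control value `v`. -/
def plant {n : ℕ} (Qs : Finset ℕ) (d : ℕ → EuclideanSpace ℝ (Fin n) → EuclideanSpace ℝ (Fin n))
    (b : ℕ → EuclideanSpace ℝ (Fin n) → Matrix (Fin n) (Fin n) ℝ)
    (q : ℕ) (x v : EuclideanSpace ℝ (Fin n)) : EuclideanSpace ℝ (Fin n) :=
  d q x + if q ∈ Qs then WithLp.toLp 2 ((b q x).mulVec (WithLp.ofLp v)) else 0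

/-- The field `f_q` for which `μ f_q` is the plant in closed loop with the feedback. It depends on
neither the input signal (which only measures the drift, see `DriftBound`) nor the timer. -/
def closedLoopField {n : ℕ} (Qs : Finset ℕ) (η δ : ℕ → ℝ)
    (dbar : ℕ → EuclideanSpace ℝ (Fin n) → ℝ)
    (d : ℕ → EuclideanSpace ℝ (Fin n) → EuclideanSpace ℝ (Fin n))
    (b : ℕ → EuclideanSpace ℝ (Fin n) → Matrix (Fin n) (Fin n) ℝ) :
    ℕ → EuclideanSpace ℝ (Fin n) → ℝ → ℝ → ℝ → EuclideanSpace ℝ (Fin n) :=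
  fun q x _u _τ μ => μ⁻¹ • plant Qs d b q x (feedback η δ dbar q x μ)

/-- The closed-loop hybrid system with state `(x, τ, ρ, q, μ)`; `x` does not jump. -/
def closedLoop {n : ℕ} (Qs Qu : Finset ℕ) (η δ : ℕ → ℝ)
    (dbar : ℕ → EuclideanSpace ℝ (Fin n) → ℝ)
    (d : ℕ → EuclideanSpace ℝ (Fin n) → EuclideanSpace ℝ (Fin n))
    (b : ℕ → EuclideanSpace ℝ (Fin n) → Matrix (Fin n) (Fin n) ℝ)
    (τd τa N₀ T₀ T k : ℝ) : HybridSystem (GainState (SwitchState n)) ℝ :=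
  blowUpSystem T k
    (switchSet n (Qs ∪ Qu) 0 N₀ T₀)
    (switchFlow (Qs ∪ Qu) Qu τd τa (closedLoopField Qs η δ dbar d b))
    (switchSet n (Qs ∪ Qu) 1 N₀ T₀)
    (switchJump (Qs ∪ Qu) (fun _ x => x))

/-- The input signal `u` bounds the magnitude of the drift relative to its known bound along the
hybrid arc: `|d_q(x)| ≤ d̄_q(x) |u|`. When `|d_q| ≤ d̄_q`, this holds for the constant signal
`u = 1` and for `u = |d_q(x)| / d̄_q(x)`. -/
def DriftBound {n : ℕ} (Q : Finset ℕ)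
    (dbar : ℕ → EuclideanSpace ℝ (Fin n) → ℝ)
    (d : ℕ → EuclideanSpace ℝ (Fin n) → EuclideanSpace ℝ (Fin n))
    (E : Set (ℝ × ℕ)) (z : ℝ → ℕ → GainState (SwitchState n)) (u : ℝ → ℕ → ℝ) : Prop :=
  ∀ t j, (t, j) ∈ E → ∀ i ∈ Q, (z t j).fst.q = (i : ℝ) →
    ‖d i (z t j).fst.x‖ ≤ dbar i (z t j).fst.x * ‖u t j‖

end PrescribedTime

end

noncomputable section

namespace PrescribedTime

/-! The Lyapunov function is `V = |x|²`, which jumps do not change. Write `W` for the supremum of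
the input, `μ` for the gain, `σ` for the dilation and `l` for half the decay rate in the stable
modes. Completing squares gives `V' ≤ μ ((κ 𝟙_{Qu} - 2l) V + c W² / μ²)` with constants that depend
only on the known data (`exists_rates`).

The monitor `ρ` pays for the unstable modes. With `τa = κ / l` one has `κ ρ' ≤ μ (l - κ 𝟙_{Qu})`, so
the weight `exp (κρ)`, which stays between `1` and `exp (κT₀)`, cancels the growth term and leaves
the rate `-l` in every mode. Since `σ' = μ`, this is a decay rate in the time scale `σ`.

The drift enters with the factor `1 / μ²`, and `μ ≥ 1 + σ/T`. Hence a multiple of `1 / (1 + aσ)`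
dominates its contribution (`exists_hasDerivAt_lyapunov`), and even the effect of a persistent drift
tends to zero. This yields `V ≤ (A² + G²) / (1 + aσ)`, where `A` decays exponentially in `σ` and `G`
is proportional to `W` (`norm_sq_x_le`). A square root gives the estimate with `βc r s = r / √(1 +
as)`. Decay in `j` is borrowed from decay in `σ`, because the dwell-time timer forces `j ≤ N₀ +
σ/τd` (`dilation_bounds`). -/

/-! ### Absolutely continuous functions -/

/-- An absolutely continuous function composed with a `C¹` function is absolutely continuous. -/
theorem _root_.AbsolutelyContinuousOnInterval.comp_contDiffAt {Z : Type*} [NormedAddCommGroup Z]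
    [NormedSpace ℝ Z] {f : ℝ → Z} {a b : ℝ} (hf : AbsolutelyContinuousOnInterval f a b)
    {F : Z → ℝ} (hF : ∀ t ∈ Set.uIcc a b, ContDiffAt ℝ 1 F (f t)) :
    AbsolutelyContinuousOnInterval (fun t => F (f t)) a b := by
  have hloc : LocallyLipschitzOn (f '' Set.uIcc a b) F := by
    rintro _ ⟨t, ht, rfl⟩
    obtain ⟨K, s, hs, hK⟩ := (hF t ht).exists_lipschitzOnWith
    exact ⟨K, s, mem_nhdsWithin_of_mem_nhds hs, hK⟩
  obtain ⟨K, hK⟩ := hloc.exists_lipschitzOnWith_of_compact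
    (isCompact_uIcc.image_of_continuousOn hf.continuousOn)
  rw [absolutelyContinuousOnInterval_iff] at hf ⊢
  intro e he
  -- Dividing by `K + 1` instead of `K` covers `K = 0` and makes the final inequality strict.
  obtain ⟨r, hr, h⟩ := hf (e / (K + 1)) (by positivity)
  refine ⟨r, hr, fun I hI hIr => ?_⟩
  have hmem : ∀ i ∈ Finset.range I.1, (I.2 i).1 ∈ Set.uIcc a b ∧ (I.2 i).2 ∈ Set.uIcc a b := hI.1
  calc ∑ i ∈ Finset.range I.1, dist (F (f (I.2 i).1)) (F (f (I.2 i).2))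
      ≤ ∑ i ∈ Finset.range I.1, K * dist (f (I.2 i).1) (f (I.2 i).2) :=
        Finset.sum_le_sum fun i hi => hK.dist_le_mul _ (Set.mem_image_of_mem f (hmem i hi).1) _
          (Set.mem_image_of_mem f (hmem i hi).2)
    _ = K * ∑ i ∈ Finset.range I.1, dist (f (I.2 i).1) (f (I.2 i).2) := by rw [Finset.mul_sum]
    _ ≤ K * (e / (K + 1)) := by gcongr; exact (h I hI hIr).le
    _ < e := by
        rw [← mul_div_assoc, div_lt_iff₀ (by positivity)]
        nlinarith [K.coe_nonneg]

/-- Mean value inequality for absolutely continuous functions. -/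
theorem _root_.AbsolutelyContinuousOnInterval.sub_le_of_ae_hasDerivAt_le {f : ℝ → ℝ} {a b c : ℝ}
    (hab : a ≤ b) (hf : AbsolutelyContinuousOnInterval f a b)
    (hd : ∀ᵐ t ∂(volume.restrict (Set.Icc a b)), ∃ r ≤ c, HasDerivAt f r t) :
    f b - f a ≤ c * (b - a) := by
  rw [← hf.integral_deriv_eq_sub]
  calc ∫ t in a..b, deriv f t ≤ ∫ _t in a..b, c := by
        refine intervalIntegral.integral_mono_ae_restrict hab hf.intervalIntegrable_deriv
          intervalIntegrable_const ?_
        filter_upwards [hd] with t ht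
        obtain ⟨r, hr, h⟩ := ht
        rwa [h.deriv]
    _ = c * (b - a) := by simp [mul_comm]

/-! ### Hybrid time domains and solutions -/

/-- Induction along a hybrid time domain. -/
theorem IsHTD.induction {E : Set (ℝ × ℕ)} (hE : IsHTD E) {P : ℝ → ℕ → Prop} (h0 : P 0 0)
    (hflow : ∀ j a b, a ≤ b → Set.Icc a b ⊆ slice E j → P a j → P b j)
    (hjump : ∀ t j, (t, j) ∈ E → (t, j + 1) ∈ E → P t j → P t (j + 1))
    {t : ℝ} {j : ℕ} (h : (t, j) ∈ E) : P t j := by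
  obtain ⟨J, s, hs0, hs, hEq⟩ := hE.2 (t, j) h
  have hsub : ∀ i < J, ∀ r, s i ≤ r → r ≤ s (i + 1) → (r, i) ∈ E := by
    intro i hi r h1 h2
    have : (r, i) ∈ {p : ℝ × ℕ | p.2 < J ∧ s p.2 ≤ p.1 ∧ p.1 ≤ s (p.2 + 1)} := ⟨hi, h1, h2⟩
    rw [← hEq] at this
    exact this.1
  -- Reach the start of each interval by alternating one flow and one jump; a last flow then leads
  -- to `(t, j)`.
  have hend : ∀ i < J, P (s i) i := by
    intro i
    induction i with
    | zero => intro _; rwa [hs0]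
    | succ i ih =>
      intro hi
      have hi' : i < J := by omega
      refine hjump _ _ (hsub i hi' _ (hs i hi') le_rfl) (hsub (i + 1) hi _ le_rfl (hs _ hi)) ?_
      exact hflow i (s i) _ (hs i hi') (fun r hr => hsub i hi' r hr.1 hr.2) (ih hi')
  have hmem : (t, j) ∈ E ∩ {p' : ℝ × ℕ | 0 ≤ p'.1 ∧ p'.1 ≤ t ∧ p'.2 ≤ j} :=
    ⟨h, hE.1 _ h, le_rfl, le_rfl⟩
  rw [hEq] at hmem
  obtain ⟨hj, h1, h2⟩ := hmem
  exact hflow j (s j) t h1 (fun r hr => hsub j hj r hr.1 (hr.2.trans h2)) (hend j hj)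

section Solutions

variable {Z U : Type*} [NormedAddCommGroup Z] [NormedSpace ℝ Z] [NormedAddCommGroup U]
  {H : HybridSystem Z U} {E : Set (ℝ × ℕ)} {z : ℝ → ℕ → Z} {u : ℝ → ℕ → U}

/-- Strictness of `a < b` matters: the flow condition is imposed only on slices with nonempty
interior. -/
theorem HybridSystem.IsSolutionPair.ae_flow (h : H.IsSolutionPair E z u) {a b : ℝ} {j : ℕ}
    (hab : a < b) (hE : Set.Icc a b ⊆ slice E j) :
    ∀ᵐ t ∂(volume.restrict (Set.Icc a b)),
      z t j ∈ H.C ∧ ∃ v ∈ H.F (z t j) (u t j), HasDerivAt (fun s => z s j) v t := by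
  refine ae_restrict_of_ae_restrict_of_subset hE (h.flow j ?_)
  refine Set.Nonempty.mono (interior_mono hE) ?_
  rw [interior_Icc]
  exact Set.nonempty_Ioo.2 hab

theorem HybridSystem.IsSolutionPair.absolutelyContinuous (h : H.IsSolutionPair E z u) {a b : ℝ}
    {j : ℕ} (hab : a ≤ b) (hE : Set.Icc a b ⊆ slice E j) :
    AbsolutelyContinuousOnInterval (fun t => z t j) a b :=
  h.arc j a (hE (Set.left_mem_Icc.2 hab)) b (hE (Set.right_mem_Icc.2 hab)) hab

/-- If the flow set is closed, contains the jump set and is reached by all jumps, then solutions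
remain in it. -/
theorem HybridSystem.IsSolutionPair.mem_flowSet (h : H.IsSolutionPair E z u) (hC : IsClosed H.C)
    (hD : H.D ⊆ H.C) (hG : ∀ y ∈ H.D, H.G y ⊆ H.C) {t : ℝ} {j : ℕ} (ht : (t, j) ∈ E) :
    z t j ∈ H.C := by
  refine h.htd.induction (P := fun t j => z t j ∈ H.C) ?_ ?_ ?_ ht
  · exact h.init.elim id fun h' => hD h'
  · intro j a b hab hE ha
    rcases hab.eq_or_lt with rfl | hlt
    · exact ha
    have hcont := (h.absolutelyContinuous hab hE).continuousOn
    rw [Set.uIcc_of_le hab] at hcont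
    -- The flow condition holds only almost everywhere and may fail at `b` itself. If `z b j` were
    -- outside the closed set, continuity would keep `z` outside on an interval to the left of `b`,
    -- which has positive measure.
    by_contra hb
    have hnhds : {t | z t j ∉ H.C} ∈ 𝓝[Set.Icc a b] b :=
      (hcont b (Set.right_mem_Icc.2 hab)).eventually (hC.isOpen_compl.mem_nhds hb)
    obtain ⟨c, hc, hsub⟩ : ∃ c < b, Set.Ioo c b ∩ Set.Icc a b ⊆ {t | z t j ∉ H.C} := by
      obtain ⟨V, hV, hVs⟩ := mem_nhdsWithin_iff_exists_mem_nhds_inter.1 hnhds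
      obtain ⟨c, hc, hcV⟩ := exists_Ioc_subset_of_mem_nhds hV ⟨a, hlt⟩
      exact ⟨c, hc, fun r hr => hVs ⟨hcV ⟨hr.1.1, hr.1.2.le⟩, hr.2⟩⟩
    have hae := ae_restrict_of_ae_restrict_of_subset
      (Set.Ioo_subset_Icc_self.trans (Set.Icc_subset_Icc_left (le_max_left a c)))
      (h.ae_flow hlt hE) (s := Set.Ioo (max a c) b)
    have hfalse : ∀ᵐ t ∂(volume.restrict (Set.Ioo (max a c) b)), False := by
      filter_upwards [hae, ae_restrict_mem measurableSet_Ioo] with r hr hr'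
      exact hsub ⟨⟨(le_max_right a c).trans_lt hr'.1, hr'.2⟩,
        (le_max_left a c).trans hr'.1.le, hr'.2.le⟩ hr.1
    rw [ae_iff] at hfalse
    simp at hfalse
    rcases hfalse with h' | h' <;> linarith
  · intro t j h1 h2 _
    exact hG _ (h.jump t j h1 h2).1 (h.jump t j h1 h2).2

/-- A bound on the derivative along flows of a `C¹` function that does not increase at jumps bounds
its increment along a solution. -/
theorem HybridSystem.IsSolutionPair.le_add_of_flow_of_jump (h : H.IsSolutionPair E z u)
    {F : ℕ → Z → ℝ} {c t : ℝ} {j : ℕ} (ht : (t, j) ∈ E)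
    (hF : ∀ s i, (s, i) ∈ E → ContDiffAt ℝ 1 (F i) (z s i))
    (hd : ∀ s i, (s, i) ∈ E → s ≤ t → i ≤ j → ∀ v ∈ H.F (z s i) (u s i),
      HasDerivAt (fun s' => z s' i) v s → ∃ r ≤ c, HasDerivAt (fun s' => F i (z s' i)) r s)
    (hj : ∀ s i, (s, i) ∈ E → (s, i + 1) ∈ E → F (i + 1) (z s (i + 1)) ≤ F i (z s i)) :
    F j (z t j) ≤ F 0 (z 0 0) + c * t := by
  refine h.htd.induction (P := fun t' j' => t' ≤ t → j' ≤ j →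
    F j' (z t' j') ≤ F 0 (z 0 0) + c * t') ?_ ?_ ?_ ht le_rfl le_rfl
  · simp
  · intro i a b hab hE ha hb hi
    rcases hab.eq_or_lt with rfl | hlt
    · exact ha hb hi
    have hinc : F i (z b i) - F i (z a i) ≤ c * (b - a) := by
      refine AbsolutelyContinuousOnInterval.sub_le_of_ae_hasDerivAt_le (f := fun s => F i (z s i))
        hab ((h.absolutelyContinuous hab hE).comp_contDiffAt fun s hs => hF _ _ (hE ?_)) ?_
      · rwa [Set.uIcc_of_le hab] at hs
      · filter_upwards [h.ae_flow hlt hE, ae_restrict_mem measurableSet_Icc] with s hs hsI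
        obtain ⟨_, v, hv, hvd⟩ := hs
        exact hd s i (hE hsI) (hsI.2.trans hb) hi v hv hvd
    linarith [ha (hab.trans hb) hi]
  · intro s i h1 h2 hs hst hi
    exact (hj s i h1 h2).trans (hs hst (by omega))

end Solutions

/-! ### Coordinates of the switching system -/

namespace SwitchState

variable {n : ℕ}

theorem ext_coords {ψ φ : SwitchState n} (hx : ψ.x = φ.x) (hτ : ψ.τ = φ.τ) (hρ : ψ.ρ = φ.ρ)
    (hq : ψ.q = φ.q) : ψ = φ := by
  apply WithLp.ofLp_injective
  refine Prod.ext hx ?_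
  ext i
  fin_cases i
  · exact hτ
  · exact hρ
  · exact hq

/-- The plant state as a continuous linear map. -/
def xL (n : ℕ) : SwitchState n →L[ℝ] EuclideanSpace ℝ (Fin n) :=
  WithLp.fstL 2 ℝ (EuclideanSpace ℝ (Fin n)) (EuclideanSpace ℝ (Fin 3))

/-- A component of `(τ, ρ, q)` as a continuous linear map. -/
def auxL (n : ℕ) (i : Fin 3) : SwitchState n →L[ℝ] ℝ :=
  (EuclideanSpace.proj i).comp
    (WithLp.sndL 2 ℝ (EuclideanSpace ℝ (Fin n)) (EuclideanSpace ℝ (Fin 3)))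

theorem continuous_τ : Continuous (τ : SwitchState n → ℝ) := (auxL n 0).continuous
theorem continuous_ρ : Continuous (ρ : SwitchState n → ℝ) := (auxL n 1).continuous
theorem continuous_q : Continuous (q : SwitchState n → ℝ) := (auxL n 2).continuous

theorem norm_sq_eq (ψ : SwitchState n) : ‖ψ‖ ^ 2 = ‖ψ.x‖ ^ 2 + ‖ψ.aux‖ ^ 2 :=
  WithLp.prod_norm_sq_eq_of_L2 (α := EuclideanSpace ℝ (Fin n)) (β := EuclideanSpace ℝ (Fin 3)) ψ

theorem norm_x_le (ψ : SwitchState n) : ‖ψ.x‖ ≤ ‖ψ‖ := by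
  refine le_of_sq_le_sq ?_ (norm_nonneg _)
  rw [norm_sq_eq]
  nlinarith [sq_nonneg ‖ψ.aux‖]

theorem x_sub (ψ φ : SwitchState n) : (ψ - φ).x = ψ.x - φ.x := rfl

theorem aux_sub (ψ φ : SwitchState n) : (ψ - φ).aux = ψ.aux - φ.aux := rfl

end SwitchState

theorem isClosed_switchSet (n : ℕ) (Q : Finset ℕ) (a N₀ T₀ : ℝ) :
    IsClosed (switchSet n Q a N₀ T₀) := by
  have hq : IsClosed {ψ : SwitchState n | ∃ i ∈ Q, ψ.q = (i : ℝ)} := by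
    have : {ψ : SwitchState n | ∃ i ∈ Q, ψ.q = (i : ℝ)} =
        SwitchState.q ⁻¹' ((fun i : ℕ => (i : ℝ)) '' (Q : Set ℕ)) := by
      ext ψ
      simp [eq_comm]
    rw [this]
    exact (Q.finite_toSet.image _).isClosed.preimage SwitchState.continuous_q
  exact (isClosed_Icc.preimage SwitchState.continuous_τ).inter
    ((isClosed_Icc.preimage SwitchState.continuous_ρ).inter hq)

theorem isCompact_targetSet (n : ℕ) (Q : Finset ℕ) (N₀ T₀ : ℝ) :
    IsCompact (targetSet n Q N₀ T₀) := by
  let f : ℝ × ℝ × ℝ → SwitchState n := fun p => SwitchState.mk 0 p.1 p.2.1 p.2.2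
  have hf : Continuous f := by
    refine (WithLp.prod_continuous_toLp 2 (EuclideanSpace ℝ (Fin n))
      (EuclideanSpace ℝ (Fin 3))).comp (continuous_const.prodMk ?_)
    refine (PiLp.continuous_toLp 2 (fun _ : Fin 3 => ℝ)).comp (continuous_pi fun i => ?_)
    fin_cases i
    · exact continuous_fst
    · exact continuous_fst.comp continuous_snd
    · exact continuous_snd.comp continuous_snd
  have heq : targetSet n Q N₀ T₀ =
      f '' (Set.Icc 0 N₀ ×ˢ Set.Icc 0 T₀ ×ˢ ((fun i : ℕ => (i : ℝ)) '' (Q : Set ℕ))) := by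
    ext ψ
    constructor
    · rintro ⟨hx, hτ, hρ, i, hi, hq⟩
      refine ⟨(ψ.τ, ψ.ρ, ψ.q), ⟨hτ, hρ, i, hi, hq.symm⟩, ?_⟩
      exact SwitchState.ext_coords hx.symm rfl rfl rfl
    · rintro ⟨⟨t, r, q⟩, ⟨hτ, hρ, i, hi, hq⟩, rfl⟩
      exact ⟨rfl, hτ, hρ, i, hi, hq.symm⟩
  rw [heq]
  exact (isCompact_Icc.prod (isCompact_Icc.prod (Q.finite_toSet.image _).isCompact)).image hf

/-- On the flow set, the distance to the target set is the norm of the plant state. -/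
theorem infDist_target {n : ℕ} {Q : Finset ℕ} {N₀ T₀ : ℝ} {z : GainState (SwitchState n)}
    (hz : z.fst ∈ switchSet n Q 0 N₀ T₀) (hμ : 1 ≤ z.snd) :
    Metric.infDist z {z' : GainState (SwitchState n) | z'.fst ∈ targetSet n Q N₀ T₀ ∧ 1 ≤ z'.snd}
      = ‖z.fst.x‖ := by
  have hmem : (WithLp.toLp 2 (SwitchState.mk 0 z.fst.τ z.fst.ρ z.fst.q, z.snd) :
      GainState (SwitchState n)) ∈
      {z' : GainState (SwitchState n) | z'.fst ∈ targetSet n Q N₀ T₀ ∧ 1 ≤ z'.snd} :=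
    ⟨⟨rfl, hz⟩, hμ⟩
  apply le_antisymm
  · refine (Metric.infDist_le_dist_of_mem hmem).trans (le_of_eq ?_)
    have h1 : ‖z - (WithLp.toLp 2 (SwitchState.mk 0 z.fst.τ z.fst.ρ z.fst.q, z.snd) :
        GainState (SwitchState n))‖ ^ 2 = ‖z.fst.x‖ ^ 2 := by
      rw [WithLp.prod_norm_sq_eq_of_L2, WithLp.sub_fst, WithLp.sub_snd, SwitchState.norm_sq_eq,
        SwitchState.x_sub, SwitchState.aux_sub]
      have h2 : z.fst.aux = (SwitchState.mk (0 : EuclideanSpace ℝ (Fin n)) z.fst.τ z.fst.ρ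
          z.fst.q).aux := by
        ext i
        fin_cases i <;> rfl
      simp [← h2]
    rw [dist_eq_norm]
    exact (sq_eq_sq₀ (norm_nonneg _) (norm_nonneg _)).1 h1
  · refine (Metric.le_infDist ⟨_, hmem⟩).2 ?_
    rintro y ⟨⟨hy, _⟩, _⟩
    rw [dist_eq_norm]
    have h1 : (z - y).fst.x = z.fst.x := by
      rw [WithLp.sub_fst, SwitchState.x_sub, hy, sub_zero]
    rw [← h1]
    refine (SwitchState.norm_x_le _).trans (le_of_sq_le_sq ?_ (norm_nonneg _))
    rw [WithLp.prod_norm_sq_eq_of_L2 (z - y)]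
    nlinarith [sq_nonneg ‖(z - y).snd‖]

/-! ### Coordinates along curves: derivatives and smoothness -/

section Curves

variable {n : ℕ} {y : ℝ → GainState (SwitchState n)} {v : GainState (SwitchState n)} {t : ℝ}

theorem hasDerivAt_x (h : HasDerivAt y v t) : HasDerivAt (fun s => (y s).fst.x) v.fst.x t :=
  ((SwitchState.xL n).comp (WithLp.fstL 2 ℝ (SwitchState n) ℝ)).hasFDerivAt.comp_hasDerivAt t h

theorem hasDerivAt_τ (h : HasDerivAt y v t) : HasDerivAt (fun s => (y s).fst.τ) v.fst.τ t :=
  ((SwitchState.auxL n 0).comp (WithLp.fstL 2 ℝ (SwitchState n) ℝ)).hasFDerivAt.comp_hasDerivAt t h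

theorem hasDerivAt_ρ (h : HasDerivAt y v t) : HasDerivAt (fun s => (y s).fst.ρ) v.fst.ρ t :=
  ((SwitchState.auxL n 1).comp (WithLp.fstL 2 ℝ (SwitchState n) ℝ)).hasFDerivAt.comp_hasDerivAt t h

theorem hasDerivAt_gain (h : HasDerivAt y v t) : HasDerivAt (fun s => (y s).snd) v.snd t :=
  (WithLp.sndL 2 ℝ (SwitchState n) ℝ).hasFDerivAt.comp_hasDerivAt t h

theorem contDiff_x : ContDiff ℝ 1 (fun z : GainState (SwitchState n) => z.fst.x) :=
  ((SwitchState.xL n).comp (WithLp.fstL 2 ℝ (SwitchState n) ℝ)).contDiff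

theorem contDiff_τ : ContDiff ℝ 1 (fun z : GainState (SwitchState n) => z.fst.τ) :=
  ((SwitchState.auxL n 0).comp (WithLp.fstL 2 ℝ (SwitchState n) ℝ)).contDiff

theorem contDiff_ρ : ContDiff ℝ 1 (fun z : GainState (SwitchState n) => z.fst.ρ) :=
  ((SwitchState.auxL n 1).comp (WithLp.fstL 2 ℝ (SwitchState n) ℝ)).contDiff

theorem contDiff_gain : ContDiff ℝ 1 (fun z : GainState (SwitchState n) => z.snd) :=
  (WithLp.sndL 2 ℝ (SwitchState n) ℝ).contDiff

end Curves

/-! ### The dilation as a function of the gain -/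

/-- Both branches of `omegaK` are primitives of the same power, since `(k - 1) / k - 1 = -(1 / k)`.
This power is the gain divided by its own speed. -/
theorem hasDerivAt_omegaK {T k b : ℝ} (a : ℝ) (hk : 1 ≤ k) (hb : 0 < b) :
    HasDerivAt (fun b => omegaK T k b a) (T / k * b ^ (-(1 / k))) b := by
  unfold omegaK
  split_ifs with h
  · subst h
    have := ((Real.hasDerivAt_log hb.ne').sub_const (Real.log a)).const_mul T
    refine this.congr_deriv ?_
    simp [Real.rpow_neg_one]
  · have hk' : (k - 1) / k ≠ 0 := div_ne_zero (sub_ne_zero.2 h) (by positivity)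
    have := ((((Real.hasDerivAt_rpow_const (p := (k - 1) / k) (Or.inl hb.ne')).sub_const
      1).div_const ((k - 1) / k)).sub_const ((a ^ ((k - 1) / k) - 1) / ((k - 1) / k))).const_mul
        (T / k)
    refine this.congr_deriv ?_
    rw [mul_div_cancel_left₀ _ hk']
    congr 2
    field_simp
    ring

theorem contDiffAt_omegaK {T k b : ℝ} (a : ℝ) (hb : 0 < b) :
    ContDiffAt ℝ 1 (fun b => omegaK T k b a) b := by
  unfold omegaK
  split_ifs with h
  · exact contDiffAt_const.mul ((Real.contDiffAt_log.2 hb.ne').sub contDiffAt_const)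
  · exact contDiffAt_const.mul (((((Real.contDiffAt_rpow_const_of_ne hb.ne').sub
      contDiffAt_const).div_const _)).sub contDiffAt_const)

theorem omegaK_self (T k a : ℝ) : omegaK T k a a = 0 := by
  unfold omegaK
  split_ifs <;> simp

/-- Along the gain dynamics, the dilation grows at the rate given by the gain. -/
theorem hasDerivAt_omegaK_gain {T k a : ℝ} (hT : 0 < T) (hk : 1 ≤ k) {m : ℝ → ℝ} {t : ℝ}
    (hm : 0 < m t) (h : HasDerivAt m (k / T * m t ^ (1 + 1 / k)) t) :
    HasDerivAt (fun s => omegaK T k (m s) a) (m t) t := by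
  refine ((hasDerivAt_omegaK a hk hm).comp t h).congr_deriv ?_
  have hk0 : k ≠ 0 := by positivity
  calc T / k * m t ^ (-(1 / k)) * (k / T * m t ^ (1 + 1 / k))
      = (T / k * (k / T)) * (m t ^ (-(1 / k)) * m t ^ (1 + 1 / k)) := by ring
    _ = m t := by
      rw [← Real.rpow_add hm]
      have : -(1 / k) + (1 + 1 / k) = 1 := by ring
      rw [this, Real.rpow_one]
      field_simp

/-- The gain that satisfies `μ^(-1/k) = μ₀^(-1/k) - t / T` is the blow-up gain. -/
theorem blowUpGain_eq {T k μ₀ μ t : ℝ} (hT : 0 < T) (hk : 1 ≤ k) (hμ : 0 < μ)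
    (h : μ ^ (-(1 / k)) = μ₀ ^ (-(1 / k)) - t / T) : blowUpGain T k μ₀ t = μ := by
  have hk0 : k ≠ 0 := by positivity
  have h1 : T * μ₀ ^ (-(1 / k)) - t = T * μ ^ (-(1 / k)) := by
    rw [h]
    field_simp
  unfold blowUpGain
  rw [h1, Real.mul_rpow hT.le (by positivity), ← Real.rpow_mul hμ.le]
  have h2 : -(1 / k) * k = -1 := by field_simp
  have hTk : T ^ k ≠ 0 := (Real.rpow_pos_of_pos hT k).ne'
  rw [h2, Real.rpow_neg_one]
  field_simp

/-! ### Growth rates of the plant state -/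

/-- The empty set is included because there may be no stable mode. -/
theorem exists_pos_lower_bound (s : Finset ℕ) (f : ℕ → ℝ) (hf : ∀ i ∈ s, 0 < f i) :
    ∃ c > 0, ∀ i ∈ s, c ≤ f i := by
  rcases s.eq_empty_or_nonempty with rfl | hs
  · exact ⟨1, one_pos, by simp⟩
  · obtain ⟨i, hi, h⟩ := s.exists_min_image f hs
    exact ⟨f i, hf i hi, h⟩

theorem exists_pos_upper_bound (s : Finset ℕ) (f : ℕ → ℝ) : ∃ c > 0, ∀ i ∈ s, f i ≤ c := by
  obtain ⟨c, hc⟩ := (s.image f).exists_le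
  exact ⟨max c 1, by positivity, fun i hi =>
    (hc _ (Finset.mem_image_of_mem f hi)).trans (le_max_left _ _)⟩

/-- A matrix and its transpose have the same quadratic form, which produces the factor `2`. -/
theorem mul_norm_sq_le_of_posSemidef {n : ℕ} {B : Matrix (Fin n) (Fin n) ℝ} {ε : ℝ}
    (hB : (B + B.transpose - ε • (1 : Matrix (Fin n) (Fin n) ℝ)).PosSemidef)
    (x : EuclideanSpace ℝ (Fin n)) :
    ε * ‖x‖ ^ 2 ≤ 2 * inner ℝ x (WithLp.toLp 2 (B.mulVec (WithLp.ofLp x))) := by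
  have h := hB.dotProduct_mulVec_nonneg (WithLp.ofLp x)
  have h1 : inner ℝ x (WithLp.toLp 2 (B.mulVec (WithLp.ofLp x))) =
      WithLp.ofLp x ⬝ᵥ B.mulVec (WithLp.ofLp x) := by
    rw [EuclideanSpace.inner_eq_star_dotProduct, dotProduct_comm]
    simp
  have h2 : WithLp.ofLp x ⬝ᵥ B.transpose.mulVec (WithLp.ofLp x) =
      WithLp.ofLp x ⬝ᵥ B.mulVec (WithLp.ofLp x) := by
    rw [Matrix.mulVec_transpose, dotProduct_comm, Matrix.dotProduct_mulVec]
  have h3 : WithLp.ofLp x ⬝ᵥ WithLp.ofLp x = ‖x‖ ^ 2 := by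
    rw [← real_inner_self_eq_norm_sq, EuclideanSpace.inner_eq_star_dotProduct]
    simp
  rw [h1]
  simp only [star_trivial, Matrix.sub_mulVec, Matrix.add_mulVec, Matrix.smul_mulVec,
    Matrix.one_mulVec, dotProduct_sub, dotProduct_add, dotProduct_smul, smul_eq_mul, h2, h3] at h
  linarith

section Plant

variable {n : ℕ} {Qs : Finset ℕ} {η δ : ℕ → ℝ} {dbar : ℕ → EuclideanSpace ℝ (Fin n) → ℝ}
  {d : ℕ → EuclideanSpace ℝ (Fin n) → EuclideanSpace ℝ (Fin n)}
  {b : ℕ → EuclideanSpace ℝ (Fin n) → Matrix (Fin n) (Fin n) ℝ} {i : ℕ}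
  {x : EuclideanSpace ℝ (Fin n)} {μ W ε : ℝ}

/-- The `η` part of the feedback provides the decay. The `δ` part contributes `-μ ε δ (d̄ |x|)²`,
which absorbs the cross term `2 d̄ |x| W` and leaves `W² / (μ ε δ)`. -/
theorem two_inner_plant_le_of_mem (hi : i ∈ Qs) (hε : 0 < ε) (hη : 0 < η i) (hδ : 0 < δ i)
    (hb : (b i x + (b i x).transpose - ε • (1 : Matrix (Fin n) (Fin n) ℝ)).PosSemidef)
    (hμ : 1 ≤ μ) (hd : ‖d i x‖ ≤ dbar i x * W) :
    2 * inner ℝ x (plant Qs d b i x (feedback η δ dbar i x μ)) ≤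
      μ * (-(ε * η i) * ‖x‖ ^ 2 + 1 / (ε * δ i) * W ^ 2 / μ ^ 2) := by
  have hμ0 : 0 < μ := by linarith
  set c : ℝ := η i + δ i * dbar i x ^ 2 with hc
  have hc0 : 0 < c := by positivity
  have hpl : plant Qs d b i x (feedback η δ dbar i x μ) =
      d i x - (μ * c) • WithLp.toLp 2 ((b i x).mulVec (WithLp.ofLp x)) := by
    rw [plant, if_pos hi, feedback, WithLp.ofLp_smul, Matrix.mulVec_smul, WithLp.toLp_smul,
      neg_smul, ← sub_eq_add_neg]
  have h1 : inner ℝ x (d i x) ≤ ‖x‖ * (dbar i x * W) :=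
    (real_inner_le_norm _ _).trans (by gcongr)
  have h2 := mul_le_mul_of_nonneg_left (mul_norm_sq_le_of_posSemidef hb x)
    (mul_pos hμ0 hc0).le
  rw [hpl, inner_sub_right, real_inner_smul_right]
  have h3 : 0 ≤ (μ * (ε * δ i) * (dbar i x * ‖x‖) - W) ^ 2 / (μ * (ε * δ i)) := by positivity
  have h4 : (μ * (ε * δ i) * (dbar i x * ‖x‖) - W) ^ 2 / (μ * (ε * δ i)) =
      μ * (ε * δ i) * (dbar i x * ‖x‖) ^ 2 - 2 * (dbar i x * ‖x‖) * W + W ^ 2 / (μ * (ε * δ i)) := by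
    field_simp
    ring
  have h5 : μ * (-(ε * η i) * ‖x‖ ^ 2 + 1 / (ε * δ i) * W ^ 2 / μ ^ 2) =
      -(μ * ε * η i) * ‖x‖ ^ 2 + W ^ 2 / (μ * (ε * δ i)) := by
    field_simp
  rw [h5]
  rw [h4] at h3
  have h6 : μ * c * (ε * ‖x‖ ^ 2) =
      μ * ε * η i * ‖x‖ ^ 2 + μ * (ε * δ i) * (dbar i x * ‖x‖) ^ 2 := by
    rw [hc]; ring
  linarith

/-- Without control, the Lipschitz bound makes the drift grow at most linearly. Young's inequality
with weight `μ` then gives the offset `d̄(0) W` the same `1 / μ²` form as in the stable modes. -/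
theorem two_inner_plant_le_of_notMem (hi : i ∉ Qs) {l : ℝ≥0} (hl : LipschitzWith l (dbar i))
    (hbar : 0 < dbar i 0) (hμ : 1 ≤ μ) (hW : 0 ≤ W) (hd : ‖d i x‖ ≤ dbar i x * W)
    (hd' : ‖d i x‖ ≤ dbar i x) (v : EuclideanSpace ℝ (Fin n)) :
    2 * inner ℝ x (plant Qs d b i x v) ≤
      μ * ((2 * l + 1) * ‖x‖ ^ 2 + dbar i 0 ^ 2 * W ^ 2 / μ ^ 2) := by
  have hμ0 : 0 < μ := by linarith
  rw [plant, if_neg hi, add_zero]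
  have h1 : inner ℝ x (d i x) ≤ ‖x‖ * ‖d i x‖ := real_inner_le_norm _ _
  have hgrow : dbar i x ≤ dbar i 0 + l * ‖x‖ := by
    have := hl.dist_le_mul x 0
    rw [dist_zero_right, Real.dist_eq] at this
    linarith [le_abs_self (dbar i x - dbar i 0)]
  -- The coefficient of `‖x‖` must not depend on `W`. For `W ≤ 1` use the bound with `W`; for `W ≥
  -- 1` use the bound `d̄` and enlarge only the constant term.
  have h2 : ‖d i x‖ ≤ dbar i 0 * W + l * ‖x‖ := by
    have hlx : 0 ≤ (l : ℝ) * ‖x‖ := by positivity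
    rcases le_total W 1 with hW1 | hW1
    · nlinarith [mul_le_mul_of_nonneg_right hgrow hW]
    · nlinarith
  have h3 : ‖x‖ * ‖d i x‖ ≤ ‖x‖ * (dbar i 0 * W + l * ‖x‖) := by gcongr
  have h4 : 0 ≤ (μ * ‖x‖ - dbar i 0 * W) ^ 2 / μ := by positivity
  have h5 : (μ * ‖x‖ - dbar i 0 * W) ^ 2 / μ =
      μ * ‖x‖ ^ 2 - 2 * ‖x‖ * (dbar i 0 * W) + dbar i 0 ^ 2 * W ^ 2 / μ := by
    field_simp
    ring
  have h6 : μ * ((2 * l + 1) * ‖x‖ ^ 2 + dbar i 0 ^ 2 * W ^ 2 / μ ^ 2) =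
      2 * (μ * (l * ‖x‖ ^ 2)) + μ * ‖x‖ ^ 2 + dbar i 0 ^ 2 * W ^ 2 / μ := by
    field_simp
  have h7 : (l : ℝ) * ‖x‖ ^ 2 ≤ μ * (l * ‖x‖ ^ 2) := le_mul_of_one_le_left (by positivity) hμ
  rw [h6]
  rw [h5] at h4
  nlinarith

end Plant

/-- Rates of decay in stable modes and of growth in unstable modes that depend only on the known
data. -/
theorem exists_rates {n : ℕ} {Qs Qu : Finset ℕ} (hdisj : Disjoint Qs Qu)
    {dbar : ℕ → EuclideanSpace ℝ (Fin n) → ℝ} (hpos : ∀ q ∈ Qs ∪ Qu, ∀ x, 0 < dbar q x)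
    (hlip : ∀ q ∈ Qu, ∃ l : ℝ≥0, LipschitzWith l (dbar q)) {η δ : ℕ → ℝ}
    (hη : ∀ q ∈ Qs ∪ Qu, 0 < η q) (hδ : ∀ q ∈ Qs ∪ Qu, 0 < δ q) {ε : ℝ} (hε : 0 < ε) :
    ∃ a > 0, ∃ κ > 0, ∃ c > 0,
      ∀ (d : ℕ → EuclideanSpace ℝ (Fin n) → EuclideanSpace ℝ (Fin n))
        (b : ℕ → EuclideanSpace ℝ (Fin n) → Matrix (Fin n) (Fin n) ℝ),
        (∀ q ∈ Qs ∪ Qu, ∀ x, ‖d q x‖ ≤ dbar q x) →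
        (∀ q ∈ Qs, ∀ x,
          (b q x + (b q x).transpose - ε • (1 : Matrix (Fin n) (Fin n) ℝ)).PosSemidef) →
        ∀ i ∈ Qs ∪ Qu, ∀ (x : EuclideanSpace ℝ (Fin n)) (μ W : ℝ), 1 ≤ μ → 0 ≤ W →
          ‖d i x‖ ≤ dbar i x * W →
          2 * inner ℝ x (plant Qs d b i x (feedback η δ dbar i x μ)) ≤
            μ * ((κ * (if i ∈ Qu then 1 else 0) - 2 * a) * ‖x‖ ^ 2 + c * W ^ 2 / μ ^ 2) := by
  choose! l hl using hlip
  obtain ⟨a₀, ha₀, ha⟩ := exists_pos_lower_bound Qs (fun i => ε * η i) fun i hi =>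
    mul_pos hε (hη i (Finset.mem_union_left _ hi))
  obtain ⟨L, hL, hLb⟩ := exists_pos_upper_bound Qu fun i => 2 * (l i : ℝ) + 1
  obtain ⟨c₁, hc₁, hc₁b⟩ := exists_pos_upper_bound Qs fun i => 1 / (ε * δ i)
  obtain ⟨c₂, hc₂, hc₂b⟩ := exists_pos_upper_bound Qu fun i => dbar i 0 ^ 2
  -- With these values `κ 𝟙 - 2a` is `-a₀` in stable modes and `L` in unstable ones.
  refine ⟨a₀ / 2, by positivity, a₀ + L, by positivity, max c₁ c₂, by positivity, ?_⟩
  intro d b hd' hb i hi x μ W hμ hW hd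
  by_cases hu : i ∈ Qu
  · have hs : i ∉ Qs := fun hs => Finset.disjoint_left.1 hdisj hs hu
    refine (two_inner_plant_le_of_notMem hs (hl i hu) (hpos i hi 0) hμ hW hd (hd' i hi x) _).trans ?_
    rw [if_pos hu]
    have h1 : 2 * (l i : ℝ) + 1 ≤ (a₀ + L) * 1 - 2 * (a₀ / 2) := by linarith [hLb i hu]
    have h2 : dbar i 0 ^ 2 ≤ max c₁ c₂ := (hc₂b i hu).trans (le_max_right _ _)
    gcongr
  · have hs : i ∈ Qs := (Finset.mem_union.1 hi).resolve_right hu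
    refine (two_inner_plant_le_of_mem hs hε (hη i hi) (hδ i hi) (hb i hs x) hμ hd).trans ?_
    rw [if_neg hu]
    have h1 : -(ε * η i) ≤ (a₀ + L) * 0 - 2 * (a₀ / 2) := by linarith [ha i hs]
    have h2 : 1 / (ε * δ i) ≤ max c₁ c₂ := (hc₁b i hs).trans (le_max_left _ _)
    gcongr

/-! ### A Lyapunov function for signals -/

/-- The Lyapunov function `exp (lσ) (V exp (κρ) - B / (1 + aσ))` is nonincreasing along flows. -/
theorem exists_hasDerivAt_lyapunov {V ρ σ : ℝ → ℝ} {V' ρ' μ t l κ a D T₀ : ℝ}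
    (hV : HasDerivAt V V' t) (hρ : HasDerivAt ρ ρ' t) (hσ : HasDerivAt σ μ t)
    (ha : 0 < a) (hal : a ≤ l / 2) (hκ : 0 ≤ κ) (hD : 0 ≤ D) (hσ0 : 0 ≤ σ t)
    (hσμ : 1 + a * σ t ≤ μ) (hρT : ρ t ≤ T₀)
    (hle : V' + κ * ρ' * V t ≤ μ * (-l * V t + D / μ ^ 2)) :
    ∃ r ≤ 0, HasDerivAt (fun s => Real.exp (l * σ s) *
      (V s * Real.exp (κ * ρ s) - 2 / l * (Real.exp (κ * T₀) * D) / (1 + a * σ s))) r t := by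
  have hl : 0 < l := by linarith
  set P := 1 + a * σ t with hP
  have hP1 : 1 ≤ P := by nlinarith
  have hP0 : 0 < P := by linarith
  have hμ0 : 0 < μ := by linarith
  set B := 2 / l * (Real.exp (κ * T₀) * D) with hB
  have hB0 : 0 ≤ B := by positivity
  refine ⟨_, ?_, ((hσ.const_mul l).exp.mul ((hV.mul (hρ.const_mul κ).exp).sub
    ((hasDerivAt_const t B).div ((hσ.const_mul a).const_add 1) hP0.ne')))⟩
  set e := Real.exp (κ * ρ t) with he
  have he0 : 0 < e := Real.exp_pos _
  have heT : e ≤ Real.exp (κ * T₀) := Real.exp_le_exp.2 (by gcongr)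
  -- This is the derivative without the factor `exp (lσ)`. The function `B / P` is a supersolution
  -- of the comparison equation in the time `σ`.
  have key : l * μ * (V t * e - B / P) + (V' * e + V t * (e * (κ * ρ')) + B * (a * μ) / P ^ 2)
      ≤ 0 := by
    have h1 : e * (V' + κ * ρ' * V t) ≤ e * (μ * (-l * V t + D / μ ^ 2)) := by gcongr
    have h2 : B * (a * μ) / P ^ 2 ≤ B * (l / 2 * μ) / P ^ 2 := by gcongr
    have h3 : l * μ * (B / P ^ 2) ≤ l * μ * (B / P) := by
      have : B / P ^ 2 ≤ B / P := by
        gcongr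
        nlinarith
      gcongr
    -- The decay of `B / P` itself costs at most half of the rate `l`; the factor `2 / l` in `B`
    -- makes the other half equal to the drift term.
    have h4 : l * μ * (B / P ^ 2) - B * (l / 2 * μ) / P ^ 2 =
        μ * (Real.exp (κ * T₀) * (D / P ^ 2)) := by
      rw [hB]
      field_simp
      ring
    have h5 : μ * (e * (D / μ ^ 2)) ≤ μ * (Real.exp (κ * T₀) * (D / P ^ 2)) := by gcongr
    linarith
  have hE := Real.exp_pos (l * σ t)
  calc _ = Real.exp (l * σ t) * (l * μ * (V t * e - B / P) +
        (V' * e + V t * (e * (κ * ρ')) + B * (a * μ) / P ^ 2)) := by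
        simp only [← hP]
        ring
    _ ≤ 0 := mul_nonpos_of_nonneg_of_nonpos hE.le key

/-! ### Solutions of the closed loop -/

section ClosedLoop

variable {n : ℕ} {Qs Qu : Finset ℕ} {η δ : ℕ → ℝ} {dbar : ℕ → EuclideanSpace ℝ (Fin n) → ℝ}
  {d : ℕ → EuclideanSpace ℝ (Fin n) → EuclideanSpace ℝ (Fin n)}
  {b : ℕ → EuclideanSpace ℝ (Fin n) → Matrix (Fin n) (Fin n) ℝ}
  {τd τa N₀ T₀ T k : ℝ}

/-- The gain multiplying the flow map cancels the `μ⁻¹` in `closedLoopField`, so the plant reappears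
undilated. -/
theorem exists_of_mem_closedLoop_F {y v : GainState (SwitchState n)} {w : ℝ} (hμ : 1 ≤ y.snd)
    (hv : v ∈ (closedLoop Qs Qu η δ dbar d b τd τa N₀ T₀ T k).F y w) :
    ∃ i ∈ Qs ∪ Qu, y.fst.q = (i : ℝ) ∧ ∃ r ∈ Set.Icc 0 (1 / τd), ∃ s ∈ Set.Icc 0 (1 / τa),
      v.fst.x = plant Qs d b i y.fst.x (feedback η δ dbar i y.fst.x y.snd) ∧
      v.fst.τ = y.snd * r ∧ v.fst.ρ = y.snd * (s - if i ∈ Qu then 1 else 0) ∧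
      v.snd = k / T * y.snd ^ (1 + 1 / k) := by
  obtain ⟨w', ⟨i, hi, hq, r, hr, s, hs, rfl⟩, rfl⟩ := hv
  refine ⟨i, hi, hq, r, hr, s, hs, ?_, rfl, rfl, rfl⟩
  exact smul_inv_smul₀ (by positivity) _

theorem snd_eq_of_mem_closedLoop_F {y v : GainState (SwitchState n)} {w : ℝ}
    (hv : v ∈ (closedLoop Qs Qu η δ dbar d b τd τa N₀ T₀ T k).F y w) :
    v.snd = k / T * y.snd ^ (1 + 1 / k) := by
  obtain ⟨w', _, rfl⟩ := hv
  rfl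

theorem eq_of_mem_closedLoop_G {y y' : GainState (SwitchState n)}
    (hy : y' ∈ (closedLoop Qs Qu η δ dbar d b τd τa N₀ T₀ T k).G y) :
    y'.fst.x = y.fst.x ∧ y'.fst.τ = y.fst.τ - 1 ∧ y'.fst.ρ = y.fst.ρ ∧ y'.snd = y.snd ∧
      ∃ i ∈ Qs ∪ Qu, y'.fst.q = (i : ℝ) := by
  obtain ⟨⟨i, _, _, i', hi', _, h⟩, hμ⟩ := hy
  refine ⟨?_, ?_, ?_, hμ, i', hi', ?_⟩ <;> rw [h] <;> rfl

variable {E : Set (ℝ × ℕ)} {z : ℝ → ℕ → GainState (SwitchState n)} {u : ℝ → ℕ → ℝ} {t : ℝ} {j : ℕ}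

/-- Jumps require `τ ≥ 1`, so the timer is still nonnegative after it drops by one. -/
theorem mem_flowSet_closedLoop
    (h : (closedLoop Qs Qu η δ dbar d b τd τa N₀ T₀ T k).IsSolutionPair E z u)
    (ht : (t, j) ∈ E) : (z t j).fst ∈ switchSet n (Qs ∪ Qu) 0 N₀ T₀ ∧ 1 ≤ (z t j).snd := by
  refine h.mem_flowSet ?_ ?_ ?_ ht
  · exact ((isClosed_switchSet n (Qs ∪ Qu) 0 N₀ T₀).preimage
      (WithLp.fstL 2 ℝ (SwitchState n) ℝ).continuous).inter
        (isClosed_Ici.preimage (WithLp.sndL 2 ℝ (SwitchState n) ℝ).continuous)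
  · rintro y ⟨⟨hτ, hy⟩, hμ⟩
    exact ⟨⟨⟨zero_le_one.trans hτ.1, hτ.2⟩, hy⟩, hμ⟩
  · rintro y ⟨⟨hτ, hρ, _⟩, hμ⟩ y' hy'
    obtain ⟨_, h2, h3, h4, h5⟩ := eq_of_mem_closedLoop_G hy'
    refine ⟨⟨?_, ?_, h5⟩, ?_⟩
    · rw [h2]
      exact ⟨by linarith [hτ.1], by linarith [hτ.2]⟩
    · rwa [h3]
    · rwa [h4]

/-- The dilation along a solution, as a function of the gain. -/
theorem dilation_eq (hT : 0 < T) (hk : 1 ≤ k)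
    (h : (closedLoop Qs Qu η δ dbar d b τd τa N₀ T₀ T k).IsSolutionPair E z u)
    (ht : (t, j) ∈ E) :
    dilation T k (z 0 0).snd t = omegaK T k (z t j).snd (z 0 0).snd := by
  have hpos : ∀ {s i}, (s, i) ∈ E → 0 < (z s i).snd := fun hs =>
    zero_lt_one.trans_le (mem_flowSet_closedLoop h hs).2
  have hsmooth : ∀ s i, (s, i) ∈ E →
      ContDiffAt ℝ 1 (fun y : GainState (SwitchState n) => y.snd ^ (-(1 / k))) (z s i) :=
    fun s i hs => contDiff_gain.contDiffAt.rpow_const_of_ne (hpos hs).ne'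
  have hder : ∀ s i, (s, i) ∈ E →
      ∀ v ∈ (closedLoop Qs Qu η δ dbar d b τd τa N₀ T₀ T k).F (z s i) (u s i),
      HasDerivAt (fun s' => z s' i) v s →
      HasDerivAt (fun s' => (z s' i).snd ^ (-(1 / k))) (-(1 / T)) s := by
    intro s i hs v hv hd
    have hd' := (hasDerivAt_gain hd).rpow_const (p := -(1 / k)) (Or.inl (hpos hs).ne')
    refine hd'.congr_deriv ?_
    have h1 : (z s i).snd ^ (1 + 1 / k) * (z s i).snd ^ (-(1 / k) - 1) = 1 := by
      rw [← Real.rpow_add (hpos hs)]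
      have : 1 + 1 / k + (-(1 / k) - 1) = 0 := by ring
      rw [this, Real.rpow_zero]
    have hk0 : k ≠ 0 := by positivity
    rw [snd_eq_of_mem_closedLoop_F hv]
    calc _ = k / T * (-(1 / k)) *
          ((z s i).snd ^ (1 + 1 / k) * (z s i).snd ^ (-(1 / k) - 1)) := by ring
      _ = _ := by rw [h1]; field_simp
  have hjump : ∀ s i, (s, i) ∈ E → (s, i + 1) ∈ E → (z s (i + 1)).snd = (z s i).snd :=
    fun s i h1 h2 => (eq_of_mem_closedLoop_G (h.jump s i h1 h2).2).2.2.2.1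
  -- The power `μ ^ (-1/k)` has constant derivative `-1/T`; applying the increment bound to it and
  -- to its negative gives equality.
  have hle := h.le_add_of_flow_of_jump (F := fun _ y => y.snd ^ (-(1 / k))) ht hsmooth
    (fun s i hs _ _ v hv hd => ⟨_, le_rfl, hder s i hs v hv hd⟩)
    (fun s i h1 h2 => by rw [hjump s i h1 h2])
  have hge := h.le_add_of_flow_of_jump (F := fun _ y => -y.snd ^ (-(1 / k))) ht
    (fun s i hs => (hsmooth s i hs).neg)
    (fun s i hs _ _ v hv hd => ⟨_, le_rfl, (hder s i hs v hv hd).neg⟩)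
    (fun s i h1 h2 => by rw [hjump s i h1 h2])
  have heq : (z t j).snd ^ (-(1 / k)) = (z 0 0).snd ^ (-(1 / k)) - t / T := by
    have : t / T = 1 / T * t := by ring
    linarith
  unfold dilation
  rw [blowUpGain_eq hT hk (hpos ht) heq, blowUpGain_eq hT hk (hpos h.zero_mem) (by simp)]

/-- The dilation is nonnegative, and bounds the gain from below and the number of jumps from
above. -/
theorem dilation_bounds (hT : 0 < T) (hk : 1 ≤ k)
    (h : (closedLoop Qs Qu η δ dbar d b τd τa N₀ T₀ T k).IsSolutionPair E z u)
    (ht : (t, j) ∈ E) :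
    0 ≤ omegaK T k (z t j).snd (z 0 0).snd ∧
      1 + omegaK T k (z t j).snd (z 0 0).snd / T ≤ (z t j).snd ∧
      j ≤ N₀ + omegaK T k (z t j).snd (z 0 0).snd / τd := by
  have hone : ∀ {s i}, (s, i) ∈ E → 1 ≤ (z s i).snd := fun hs => (mem_flowSet_closedLoop h hs).2
  have hpos : ∀ {s i}, (s, i) ∈ E → 0 < (z s i).snd := fun hs => zero_lt_one.trans_le (hone hs)
  have hsmooth : ∀ s i, (s, i) ∈ E → ContDiffAt ℝ 1
      (fun y : GainState (SwitchState n) => omegaK T k y.snd (z 0 0).snd) (z s i) :=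
    fun s i hs => (contDiffAt_omegaK _ (hpos hs)).comp (z s i) contDiff_gain.contDiffAt
  have hgain : ∀ s i, (s, i) ∈ E →
      ∀ v ∈ (closedLoop Qs Qu η δ dbar d b τd τa N₀ T₀ T k).F (z s i) (u s i),
      HasDerivAt (fun s' => z s' i) v s →
      HasDerivAt (fun s' => (z s' i).snd) (k / T * (z s i).snd ^ (1 + 1 / k)) s :=
    fun s i hs v hv hd => (hasDerivAt_gain hd).congr_deriv (snd_eq_of_mem_closedLoop_F hv)
  have hder := fun s i hs v hv hd =>
    hasDerivAt_omegaK_gain (a := (z 0 0).snd) hT hk (hpos hs) (hgain s i hs v hv hd)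
  have hjump := fun s i h1 h2 => eq_of_mem_closedLoop_G (h.jump s i h1 h2).2
  refine ⟨?_, ?_, ?_⟩
  · have := h.le_add_of_flow_of_jump (F := fun _ y => -omegaK T k y.snd (z 0 0).snd) (c := 0) ht
      (fun s i hs => (hsmooth s i hs).neg)
      (fun s i hs _ _ v hv hd =>
        ⟨_, neg_nonpos.2 (hpos hs).le, (hder s i hs v hv hd).neg⟩)
      (fun s i h1 h2 => by rw [(hjump s i h1 h2).2.2.2.1])
    simp only [omegaK_self] at this
    linarith
  · have := h.le_add_of_flow_of_jump (F := fun _ y => omegaK T k y.snd (z 0 0).snd / T - y.snd)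
      (c := 0) ht
      (fun s i hs => ((hsmooth s i hs).div_const T).sub contDiff_gain.contDiffAt)
      (fun s i hs _ _ v hv hd =>
        ⟨_, ?_, ((hder s i hs v hv hd).div_const T).sub (hgain s i hs v hv hd)⟩)
      (fun s i h1 h2 => by rw [(hjump s i h1 h2).2.2.2.1])
    · simp only [omegaK_self, zero_div] at this
      have := hone h.zero_mem
      linarith
    -- Because `μ ≥ 1` and `k ≥ 1`, the gain grows at least as fast as `σ / T`.
    · have h1 : (z s i).snd ≤ k * (z s i).snd ^ (1 + 1 / k) := by
        have h2 : (z s i).snd ^ (1 : ℝ) ≤ (z s i).snd ^ (1 + 1 / k) :=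
          Real.rpow_le_rpow_of_exponent_le (hone hs)
            (by linarith [show 0 ≤ 1 / k by positivity])
        rw [Real.rpow_one] at h2
        exact h2.trans (le_mul_of_one_le_left (hpos hs |>.le.trans h2) hk)
      have h2 : (z s i).snd / T ≤ k * (z s i).snd ^ (1 + 1 / k) / T := by gcongr
      rw [mul_div_right_comm] at h2
      linarith
  -- Jumps preserve `τ + j`, and flows increase it no faster than `σ / τd`; the timer starts at most
  -- at `N₀` and ends at least at `0`.
  · have := h.le_add_of_flow_of_jump
      (F := fun m y => y.fst.τ + m - omegaK T k y.snd (z 0 0).snd / τd) (c := 0) ht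
      (fun s i hs => (contDiff_τ.contDiffAt.add contDiffAt_const).sub
        ((hsmooth s i hs).div_const τd))
      (fun s i hs _ _ v hv hd =>
        ⟨_, ?_, ((hasDerivAt_τ hd).add_const (i : ℝ)).sub ((hder s i hs v hv hd).div_const τd)⟩)
      (fun s i h1 h2 => ?_)
    · simp only [omegaK_self, zero_div] at this
      have h0 := (mem_flowSet_closedLoop h h.zero_mem).1.1.2
      have h1 := (mem_flowSet_closedLoop h ht).1.1.1
      push_cast at this
      linarith
    · obtain ⟨_, _, _, r, hr, _, _, _, hτ, _⟩ := exists_of_mem_closedLoop_F (hone hs) hv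
      have h1 : (z s i).snd * r ≤ (z s i).snd * (1 / τd) :=
        mul_le_mul_of_nonneg_left hr.2 (hpos hs).le
      rw [hτ]
      rw [mul_one_div] at h1
      linarith
    · rw [(hjump s i h1 h2).2.2.2.1, (hjump s i h1 h2).2.1]
      push_cast
      linarith

/-- Decay of the plant state along solutions. -/
theorem norm_sq_x_le {a l κ c W : ℝ} (hT : 0 < T) (hk : 1 ≤ k) (hκ : 0 < κ)
    (hc : 0 ≤ c) (ha : 0 < a) (hal : a ≤ l / 2) (haT : a ≤ 1 / T) (hτa : τa = κ / l)
    (hrate : ∀ i ∈ Qs ∪ Qu, ∀ (x : EuclideanSpace ℝ (Fin n)) (μ : ℝ), 1 ≤ μ →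
      ‖d i x‖ ≤ dbar i x * W →
      2 * inner ℝ x (plant Qs d b i x (feedback η δ dbar i x μ)) ≤
        μ * ((κ * (if i ∈ Qu then 1 else 0) - 2 * l) * ‖x‖ ^ 2 + c * W ^ 2 / μ ^ 2))
    (hpos : ∀ q ∈ Qs ∪ Qu, ∀ x, 0 < dbar q x)
    (h : (closedLoop Qs Qu η δ dbar d b τd τa N₀ T₀ T k).IsSolutionPair E z u)
    (hadm : DriftBound (Qs ∪ Qu) dbar d E z u) (ht : (t, j) ∈ E)
    (hu : ∀ s i, (s, i) ∈ E → s ≤ t → i ≤ j → ‖u s i‖ ≤ W) :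
    ‖(z t j).fst.x‖ ^ 2 ≤ (Real.exp (κ * T₀) *
        Real.exp (-(l / 2 * omegaK T k (z t j).snd (z 0 0).snd)) * ‖(z 0 0).fst.x‖ ^ 2 +
      2 / l * (Real.exp (κ * T₀) * (c * W ^ 2))) /
        (1 + a * omegaK T k (z t j).snd (z 0 0).snd) := by
  have hl : 0 < l := by linarith
  have hone : ∀ {s i}, (s, i) ∈ E → 1 ≤ (z s i).snd := fun hs => (mem_flowSet_closedLoop h hs).2
  have hsnd : ∀ {s i}, (s, i) ∈ E → 0 < (z s i).snd := fun hs => zero_lt_one.trans_le (hone hs)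
  have hω : ∀ {s i}, (s, i) ∈ E → 0 ≤ omegaK T k (z s i).snd (z 0 0).snd := fun hs =>
    (dilation_bounds hT hk h hs).1
  have hsmooth : ∀ s i, (s, i) ∈ E → ContDiffAt ℝ 1
      (fun y : GainState (SwitchState n) => omegaK T k y.snd (z 0 0).snd) (z s i) :=
    fun s i hs => (contDiffAt_omegaK _ (hsnd hs)).comp (z s i) contDiff_gain.contDiffAt
  set B := 2 / l * (Real.exp (κ * T₀) * (c * W ^ 2)) with hB
  have hB0 : 0 ≤ B := by positivity
  have hY := h.le_add_of_flow_of_jump (F := fun _ y =>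
      Real.exp (l * omegaK T k y.snd (z 0 0).snd) *
        (‖y.fst.x‖ ^ 2 * Real.exp (κ * y.fst.ρ) - B / (1 + a * omegaK T k y.snd (z 0 0).snd)))
      (c := 0) ht ?_ ?_ ?_
  · simp only [omegaK_self, mul_zero, Real.exp_zero, one_mul, zero_mul, add_zero, div_one] at hY
    set σ := omegaK T k (z t j).snd (z 0 0).snd with hσ
    have hσ0 : 0 ≤ σ := hω ht
    have hP : 0 < 1 + a * σ := by positivity
    have hρ := (mem_flowSet_closedLoop h ht).1.2.1
    have hρ0 := (mem_flowSet_closedLoop h h.zero_mem).1.2.1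
    have h1 : ‖(z t j).fst.x‖ ^ 2 ≤ ‖(z t j).fst.x‖ ^ 2 * Real.exp (κ * (z t j).fst.ρ) :=
      le_mul_of_one_le_right (by positivity) (Real.one_le_exp (mul_nonneg hκ.le hρ.1))
    have h2 : ‖(z 0 0).fst.x‖ ^ 2 * Real.exp (κ * (z 0 0).fst.ρ) ≤
        ‖(z 0 0).fst.x‖ ^ 2 * Real.exp (κ * T₀) := by
      gcongr
      exact hρ0.2
    have h3 : ‖(z t j).fst.x‖ ^ 2 - B / (1 + a * σ) ≤
        Real.exp (-(l * σ)) * (Real.exp (κ * T₀) * ‖(z 0 0).fst.x‖ ^ 2) := by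
      rw [Real.exp_neg, inv_mul_eq_div, le_div_iff₀ (Real.exp_pos _)]
      have := mul_le_mul_of_nonneg_left (sub_le_sub_right h1 (B / (1 + a * σ)))
        (Real.exp_pos (l * σ)).le
      linarith
    -- Half of the exponential decay is spent to put the initial-state term over the common
    -- denominator `1 + aσ`.
    have h4 : Real.exp (-(l * σ)) * (1 + a * σ) ≤ Real.exp (-(l / 2 * σ)) := by
      calc Real.exp (-(l * σ)) * (1 + a * σ) ≤ Real.exp (-(l * σ)) * Real.exp (l / 2 * σ) := by
            gcongr
            have h5 : a * σ ≤ l / 2 * σ := by gcongr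
            linarith [Real.add_one_le_exp (l / 2 * σ)]
        _ = Real.exp (-(l / 2 * σ)) := by
            rw [← Real.exp_add]
            ring_nf
    rw [le_div_iff₀ hP]
    have h5 := mul_le_mul_of_nonneg_right h3 hP.le
    rw [sub_mul, div_mul_cancel₀ _ hP.ne'] at h5
    have h6 := mul_le_mul_of_nonneg_right h4
      (show 0 ≤ Real.exp (κ * T₀) * ‖(z 0 0).fst.x‖ ^ 2 by positivity)
    linarith
  · intro s i hs
    have hP : 1 + a * omegaK T k (z s i).snd (z 0 0).snd ≠ 0 :=
      (add_pos_of_pos_of_nonneg one_pos (mul_nonneg ha.le (hω hs))).ne'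
    exact (contDiffAt_const.mul (hsmooth s i hs)).exp.mul
      (((contDiff_x.contDiffAt.norm_sq ℝ).mul
        (contDiffAt_const.mul contDiff_ρ.contDiffAt).exp).sub
          (contDiffAt_const.div (contDiffAt_const.add
            (contDiffAt_const.mul (hsmooth s i hs))) hP))
  · intro s i hs hst hij v hv hd
    obtain ⟨m, hm, hq, r, hr, q, hq', hx, _, hρ, hg⟩ := exists_of_mem_closedLoop_F (hone hs) hv
    have hgain : HasDerivAt (fun s' => (z s' i).snd) (k / T * (z s i).snd ^ (1 + 1 / k)) s :=
      (hasDerivAt_gain hd).congr_deriv hg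
    have hb := dilation_bounds hT hk h hs
    refine exists_hasDerivAt_lyapunov (hasDerivAt_x hd).norm_sq (hasDerivAt_ρ hd)
      (hasDerivAt_omegaK_gain (a := (z 0 0).snd) hT hk (hsnd hs) hgain) ha hal hκ.le
      (by positivity) hb.1 ?_ (mem_flowSet_closedLoop h hs).1.2.1.2 ?_
    · have := mul_le_mul_of_nonneg_right haT hb.1
      rw [one_div_mul_eq_div] at this
      linarith [hb.2.1]
    · have hdr : ‖d m (z s i).fst.x‖ ≤ dbar m (z s i).fst.x * W :=
        (hadm s i hs m hm hq).trans
          (mul_le_mul_of_nonneg_left (hu s i hs hst hij) (hpos m hm _).le)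
      have h1 := hrate m hm _ _ (hone hs) hdr
      rw [hx, hρ]
      -- Here the activation constant enters: the upward drift of the monitor uses up at most `l` of
      -- the available decay rate `2l`.
      have h2 : κ * q ≤ l := by
        have := mul_le_mul_of_nonneg_left hq'.2 hκ.le
        rw [hτa] at this
        refine this.trans (le_of_eq ?_)
        field_simp
      have h3 : 0 ≤ (z s i).snd * ((l - κ * q) * ‖(z s i).fst.x‖ ^ 2) :=
        mul_nonneg (hsnd hs).le (mul_nonneg (by linarith) (by positivity))
      linarith
  · intro s i h1 h2
    obtain ⟨hx, _, hρ, hg, _⟩ := eq_of_mem_closedLoop_G (h.jump s i h1 h2).2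
    simp only [hx, hρ, hg, le_refl]

end ClosedLoop

/-! ### Comparison functions -/

/-- The constant `q` holds the contribution of the frozen argument when a `KLL` function is checked.
-/
theorem isClassKL_mul_exp {K p q : ℝ} (hK : 0 ≤ K) (hp : 0 < p) :
    IsClassKL fun r s => K * r * Real.exp (-(p * s + q)) where
  nonneg r s hr _ := by positivity
  monotoneOn s _ r _ r' _ h := by
    dsimp only
    gcongr
  antitoneOn r hr s _ s' _ h := by
    dsimp only
    have : 0 ≤ K * r := mul_nonneg hK hr
    gcongr
  tendsto_left s _ := by
    have h : Continuous fun r : ℝ => K * r * Real.exp (-(p * s + q)) := by fun_prop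
    simpa using (h.tendsto 0).mono_left nhdsWithin_le_nhds
  tendsto_right r _ := by
    have h : Tendsto (fun s : ℝ => p * s + q) atTop atTop :=
      tendsto_atTop_add_const_right _ _ (tendsto_id.const_mul_atTop hp)
    simpa using (Real.tendsto_exp_neg_atTop_nhds_zero.comp h).const_mul (K * r)

theorem isClassKLL_mul_exp {K p p' : ℝ} (hK : 0 ≤ K) (hp : 0 < p) (hp' : 0 < p') :
    IsClassKLL fun r s m => K * r * Real.exp (-(p * s + p' * m)) where
  kl_third s _ := by
    simpa only [add_comm] using isClassKL_mul_exp (q := p * s) hK hp'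
  kl_second s _ := isClassKL_mul_exp hK hp

theorem isClassKL_div_sqrt {a : ℝ} (ha : 0 < a) :
    IsClassKL fun r s => r / Real.sqrt (1 + a * s) where
  nonneg r s hr _ := by positivity
  monotoneOn s _ r _ r' _ h := by
    dsimp only
    gcongr
  antitoneOn r hr s hs s' _ h := by
    dsimp only
    have h0 : 0 < 1 + a * s := add_pos_of_pos_of_nonneg one_pos (mul_nonneg ha.le hs)
    have h1 : 0 ≤ r := hr
    gcongr
  tendsto_left s _ := by
    have h : Continuous fun r : ℝ => r / Real.sqrt (1 + a * s) := by fun_prop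
    simpa using (h.tendsto 0).mono_left nhdsWithin_le_nhds
  tendsto_right r _ :=
    tendsto_const_nhds.div_atTop (Real.tendsto_sqrt_atTop.comp
      (tendsto_atTop_add_const_left _ _ (tendsto_id.const_mul_atTop ha)))

theorem isClassK_mul {g : ℝ} (hg : 0 < g) : IsClassK fun v => g * v where
  continuousOn := by fun_prop
  strictMonoOn := (strictMono_mul_left_of_pos hg).strictMonoOn _
  map_zero := mul_zero g

theorem le_add_div_sqrt_of_sq_le {x A G P : ℝ} (hA : 0 ≤ A) (hG : 0 ≤ G) (hP : 0 < P)
    (h : x ^ 2 ≤ (A ^ 2 + G ^ 2) / P) : x ≤ (A + G) / Real.sqrt P := by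
  refine le_of_sq_le_sq (h.trans ?_) (by positivity)
  rw [div_pow, Real.sq_sqrt hP.le]
  gcongr
  nlinarith

end PrescribedTime

/-! ### The main theorem -/

open PrescribedTime

theorem proposition4 (n N : ℕ) (Qs Qu : Finset ℕ)
    (hQ : Qs ∪ Qu = Finset.Icc 1 N) (hdisj : Disjoint Qs Qu) (hQu : Qu.Nonempty)
    (dbar : ℕ → EuclideanSpace ℝ (Fin n) → ℝ)
    (hdbar_pos : ∀ q ∈ Qs ∪ Qu, ∀ x, 0 < dbar q x)
    (hdbar_cont : ∀ q ∈ Qs ∪ Qu, Continuous (dbar q))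
    (hdbar_lip : ∀ q ∈ Qu, ∃ l : ℝ≥0, LipschitzWith l (dbar q))
    (η δ : ℕ → ℝ) (hη : ∀ q ∈ Qs ∪ Qu, 0 < η q) (hδ : ∀ q ∈ Qs ∪ Qu, 0 < δ q)
    (ε : ℝ) (hε : 0 < ε) :
    ∃ τd : ℝ, 0 < τd ∧ ∃ τa : ℝ, 0 < τa ∧
      ∀ (d : ℕ → EuclideanSpace ℝ (Fin n) → EuclideanSpace ℝ (Fin n))
        (b : ℕ → EuclideanSpace ℝ (Fin n) → Matrix (Fin n) (Fin n) ℝ),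
        (∀ q ∈ Qs ∪ Qu, LocallyLipschitz (d q)) →
        (∀ q ∈ Qs ∪ Qu, ∀ i j, LocallyLipschitz (fun x => b q x i j)) →
        (∀ q ∈ Qs ∪ Qu, ∀ x, ‖d q x‖ ≤ dbar q x) →
        (∀ q ∈ Qs, ∀ x,
          (b q x + (b q x).transpose - ε • (1 : Matrix (Fin n) (Fin n) ℝ)).PosSemidef) →
        ∀ N₀ T₀ T k : ℝ, 1 ≤ N₀ → 0 ≤ T₀ → 0 < T → 1 ≤ k →
          PrescribedTime.PTISSC T k
            (PrescribedTime.closedLoop Qs Qu η δ dbar d b τd τa N₀ T₀ T k)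
            (PrescribedTime.targetSet n (Qs ∪ Qu) N₀ T₀)
            (PrescribedTime.DriftBound (Qs ∪ Qu) dbar d) := by
  obtain ⟨l, hl, κ, hκ, c, hc, hrate⟩ :=
    exists_rates hdisj hdbar_pos hdbar_lip hη hδ hε
  -- Any positive `τd` would do: jumps leave the Lyapunov function unchanged, and the dwell time
  -- only limits the number of jumps. The value of `τa` lets the monitor compensate the unstable
  -- modes.
  refine ⟨1, one_pos, κ / l, by positivity, ?_⟩
  intro d b _ _ hd hb N₀ T₀ T k _ hT₀ hT hk
  refine ⟨isCompact_targetSet _ _ _ _, ?_⟩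
  set K := Real.sqrt (Real.exp (κ * T₀)) with hK
  set g := Real.sqrt (2 / l * (Real.exp (κ * T₀) * c)) with hg
  have hg0 : 0 < g := Real.sqrt_pos.2 (by positivity)
  -- The bound `1 / T` ensures `1 + aσ ≤ μ`; the bound `l / 2` keeps the decay of `1 / (1 + aσ)`
  -- slower than the exponential one.
  set a := min (1 / T) (l / 2) with ha
  have ha0 : 0 < a := by positivity
  refine ⟨fun r s m => K * Real.exp (l / 8 * N₀) * r * Real.exp (-(l / 8 * s + l / 8 * m)),
    fun v => g * v, fun r s => r / Real.sqrt (1 + a * s),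
    isClassKLL_mul_exp (by positivity) (by positivity) (by positivity),
    isClassK_mul hg0, isClassKL_div_sqrt ha0, ?_⟩
  intro E z u h hadm t j ht hbdd
  have hC := mem_flowSet_closedLoop h ht
  have hC0 := mem_flowSet_closedLoop h h.zero_mem
  rw [infDist_target hC.1 hC.2, infDist_target hC0.1 hC0.2, dilation_eq hT hk h ht]
  set W := sSup (inputNorms E u t j) with hW
  have hu : ∀ s i, (s, i) ∈ E → s ≤ t → i ≤ j → ‖u s i‖ ≤ W := fun s i hs hst hij =>
    le_csSup hbdd ⟨s, i, hs, hst, hij, rfl⟩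
  have hW0 : 0 ≤ W := (norm_nonneg _).trans (hu t j ht le_rfl le_rfl)
  have hmain := norm_sq_x_le hT hk hκ hc.le ha0 (min_le_right _ _) (min_le_left _ _) rfl
    (fun i hi x μ hμ hdx => hrate d b hd hb i hi x μ W hμ hW0 hdx) hdbar_pos h hadm ht hu
  obtain ⟨hσ0, _, hj⟩ := dilation_bounds hT hk h ht
  rw [div_one] at hj
  set σ := omegaK T k (z t j).snd (z 0 0).snd with hσ
  have hP : 0 < 1 + a * σ := by positivity
  refine le_add_div_sqrt_of_sq_le (by positivity) (by positivity) hP (hmain.trans ?_)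
  have h1 : (g * W) ^ 2 = 2 / l * (Real.exp (κ * T₀) * (c * W ^ 2)) := by
    rw [mul_pow, hg, Real.sq_sqrt (by positivity)]
    ring
  -- The rate `l / 2` for `V` is `l / 4` for `|x|`, shared equally between `σ` and `j` through `j ≤
  -- N₀ + σ`; this explains `l / 8` and the factor `exp (l / 8 * N₀)` in `β`.
  have h2 : Real.exp (-(l / 2 * σ)) ≤
      (Real.exp (l / 8 * N₀) * Real.exp (-(l / 8 * σ + l / 8 * j))) ^ 2 := by
    rw [← Real.exp_add, ← Real.exp_nat_mul]
    refine Real.exp_le_exp.2 ?_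
    have h3 : l / 8 * j ≤ l / 8 * (N₀ + σ) := by gcongr
    push_cast
    linarith
  have h3 : (K * Real.exp (l / 8 * N₀) * ‖(z 0 0).fst.x‖ *
      Real.exp (-(l / 8 * σ + l / 8 * j))) ^ 2 = Real.exp (κ * T₀) *
        (Real.exp (l / 8 * N₀) * Real.exp (-(l / 8 * σ + l / 8 * j))) ^ 2 *
          ‖(z 0 0).fst.x‖ ^ 2 := by
    have hK2 : K ^ 2 = Real.exp (κ * T₀) := Real.sq_sqrt (Real.exp_pos _).le
    rw [← hK2]
    ring
  rw [h1, h3]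
  gcongr

end
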